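/- An overpartition of an integer $n\ge 0$ is a non-increasing finite sequence of positive integers (parts) $d_1\ge d_2\ge\cdots\ge d_s$ with sum $n$ (for $n=0$, the empty sequence), in which the first occurrence of each integer may be overlined (the overlining carries no numerical weight, and all other occurrences are non-overlined). For integers $k\ge i\ge 1$ and $n\ge 0$, let $D_{k,i}(n)$ denote the number of overpartitions $d_1+d_2+\cdots+d_s$ of $n$ such that $1$ occurs as a non-overlined part at most $i-1$ times and such that, for all $1\le j\le s-k+1$, one has $d_j-d_{j+k-1}\ge 1$ if $d_j$ is overlined and $d_j-d_{j+k-1}\ge 2$ otherwise. For $k>i\ge 1$, let $C_{k,i}(n)$ denote the number of overpartitions of $n$ whose non-overlined parts are not congruent to $0,\pm i$ modulo $2k$, and let $C_{k,k}(n)$ denote the number of overpartitions of $n$ none of whose parts, overlined or non-overlined, is divisible by $k$. Then for all $k\ge i\ge 1$ and all $n\ge 0$, $$C_{k,i}(n)=D_{k,i}(n).$$ -/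

import Mathlib

/-- An overpartition of `n`: a non-increasing finite sequence of positive integers with sum `n`,
in which the first occurrence of each integer may be overlined. An entry `(a, true)` is the
overlined part `a`, an entry `(a, false)` is the non-overlined part `a`. -/
@[ext]
structure Overpartition (n : ℕ) where
  /-- The parts `d₁, d₂, …, d_s`, in the order in which they are written. -/
  parts : List (ℕ × Bool)
  pos : ∀ p ∈ parts, 0 < p.1
  sorted : parts.Pairwise (fun p q => q.1 ≤ p.1)
  /-- A part that is preceded by a part of the same size is not overlined. -/
  overlined_first : parts.Pairwise (fun p q => p.1 = q.1 → q.2 = false)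
  sum_eq : (parts.map Prod.fst).sum = n

namespace Overpartition

/-- There are finitely many overpartitions of `n`, so that `Nat.card` below really counts. -/
instance finite (n : ℕ) : Finite (Overpartition n) := by
  have hlen : ∀ l : List (ℕ × Bool), (∀ p ∈ l, 0 < p.1) →
      l.length ≤ (l.map Prod.fst).sum := by
    intro l
    induction l with
    | nil => simp
    | cons a l ih =>
      intro h
      have h1 := h a (by simp)
      have h2 := ih (fun p hp => h p (by simp [hp]))
      simp only [List.length_cons, List.map_cons, List.sum_cons]
      omega
  have hle : ∀ (o : Overpartition n), ∀ p ∈ o.parts, p.1 < n + 1 := by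
    intro o p hp
    have h := List.single_le_sum (l := o.parts.map Prod.fst) (by simp) p.1
      (List.mem_map_of_mem hp)
    rw [o.sum_eq] at h
    omega
  have hfin : Finite {l : List (Fin (n + 1) × Bool) | l.length ≤ n} :=
    (List.finite_length_le (Fin (n + 1) × Bool) n).to_subtype
  let g : Overpartition n → {l : List (Fin (n + 1) × Bool) | l.length ≤ n} := fun o =>
    ⟨o.parts.map (fun p => (Fin.ofNat (n + 1) p.1, p.2)), by
      have h := hlen o.parts o.pos
      rw [o.sum_eq] at h
      simpa using h⟩
  refine Finite.of_injective g ?_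
  intro o₁ o₂ h
  have hback : ∀ o : Overpartition n,
      (g o).1.map (fun p => ((p.1 : ℕ), p.2)) = o.parts := by
    intro o
    simp only [g, List.map_map]
    conv_rhs => rw [← List.map_id o.parts]
    refine List.map_congr_left ?_
    intro p hp
    simp [Nat.mod_eq_of_lt (hle o p hp)]
  apply Overpartition.ext
  rw [← hback o₁, ← hback o₂, h]

/-- The non-overlined part `1` occurs at most `i - 1` times, and `d_j - d_{j+k-1} ≥ 1` if `d_j` is
overlined, `d_j - d_{j+k-1} ≥ 2` otherwise, for all `j` such that `d_j` and `d_{j+k-1}` exist. -/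
def DifferenceCondition (k i : ℕ) {n : ℕ} (o : Overpartition n) : Prop :=
  o.parts.count (1, false) ≤ i - 1 ∧
  ∀ (j : ℕ) (h : j + (k - 1) < o.parts.length),
    ((o.parts[j]).1 : ℤ) - ((o.parts[j + (k - 1)]).1 : ℤ) ≥
      if (o.parts[j]).2 = true then 1 else 2

/-- For `i ≠ k`: no non-overlined part is congruent to `0`, `i` or `-i` modulo `2k`.
For `i = k`: no part, overlined or not, is divisible by `k`. -/
def CongruenceCondition (k i : ℕ) {n : ℕ} (o : Overpartition n) : Prop :=
  if i = k then
    ∀ p ∈ o.parts, ¬ k ∣ p.1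
  else
    ∀ p ∈ o.parts, p.2 = false →
      ¬ (p.1 : ℤ) ≡ 0 [ZMOD 2 * k] ∧
      ¬ (p.1 : ℤ) ≡ i [ZMOD 2 * k] ∧
      ¬ (p.1 : ℤ) ≡ -i [ZMOD 2 * k]

/-- The number `D_{k,i}(n)`. -/
noncomputable def countD (k i n : ℕ) : ℕ :=
  Nat.card {o : Overpartition n // o.DifferenceCondition k i}

/-- The number `C_{k,i}(n)`. -/
noncomputable def countC (k i n : ℕ) : ℕ :=
  Nat.card {o : Overpartition n // o.CongruenceCondition k i}

end Overpartition

/-! Write `f a` and `g a` for the numbers of non-overlined and overlined parts `a`. An overpartition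
is determined by its multiset of parts, and the difference condition becomes `f (l + 1) + f l + g l
< k` for all `l ≥ 1`, together with `f 1 < i`.

Let `D i m` be the generating function of such multisets with all parts above `m` and `f (m + 1) <
i`. Splitting off the parts `m + 1` gives `D (i+1) m = D i m + X^((m+1)i) (D (k-i) (m+1) + X^(m+1) D
(k-i-1) (m+1))` (`genFun_differenceClass_succ`). Andrews' series obey the same recurrence, because
the discrepancy telescopes (`andrewsTerm_recurrence`). Together with `D 0 m = 0` and `D i m → 1` as
`m → ∞`, the recurrence determines `D`; hence `D i 0` is the series at `m = 0` divided by `(q; q)_∞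
/ (-q; q)_∞` (`mul_eq_sum_andrewsTerm`).

At `m = 0` the series is a theta series, which Jacobi's triple product (`triple_product_eq_sum`)
turns into `(q^i, q^(2k-i), q^(2k); q^(2k))_∞`. For `i < k` the resulting product is visibly the
generating function of `C`. For `i = k` one also needs Euler's identity `(-Q; Q)_∞ (Q; Q²)_∞ = 1` at
`Q = q^k` (`prod_range_one_add_mul_odd`).

To compare coefficients of `X^n`, everything is computed in `ℤ⟦X⟧ / (X^(n+1))`. There `q` is
nilpotent, so finite sums and products suffice and every `1 ± q^j` with `j ≥ 1` is a unit. -/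

open Finset

/-! ### Andrews' series and their recurrence. -/

section ThetaRecurrence

variable {R : Type*} [CommRing R]

/-- The quotient `(q^{n+1}; q)_m / (-q^{n+1}; q)_m`, where `v j` is the inverse of `1 + q^{j+1}`. -/
def pochhammerRatio (q : R) (v : ℕ → R) (n m : ℕ) : R :=
  ∏ j ∈ range m, (1 - q ^ (n + j + 1)) * v (n + j)

/-- The `n`-th term of the series of Andrews' function `H_{k,i}(-1/q; q^{m+1}; q)`, up to a factor
that depends on `q` only. -/
def andrewsTerm (q : R) (v : ℕ → R) (k i m n : ℕ) : R :=
  (-1) ^ n * q ^ (m * k * n + k * n ^ 2 + (k - i) * n) * (1 - q ^ ((2 * n + 1 + m) * i)) *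
    pochhammerRatio q v n m

variable {q : R} {v : ℕ → R}

theorem pochhammerRatio_succ_right (hv : ∀ j, (1 + q ^ (j + 1)) * v j = 1) (n m : ℕ) :
    (1 + q ^ (n + m + 1)) * pochhammerRatio q v n (m + 1) =
      (1 - q ^ (n + m + 1)) * pochhammerRatio q v n m := by
  rw [pochhammerRatio, prod_range_succ, ← pochhammerRatio]
  linear_combination (1 - q ^ (n + m + 1)) * pochhammerRatio q v n m * hv (n + m)

theorem pochhammerRatio_succ_left (hv : ∀ j, (1 + q ^ (j + 1)) * v j = 1) (n m : ℕ) :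
    (1 + q ^ (n + 1)) * pochhammerRatio q v n (m + 1) =
      (1 - q ^ (n + 1)) * pochhammerRatio q v (n + 1) m := by
  have h : pochhammerRatio q v n (m + 1) =
      pochhammerRatio q v (n + 1) m * ((1 - q ^ (n + 1)) * v n) := by
    rw [pochhammerRatio, prod_range_succ', pochhammerRatio]
    simp only [add_zero]
    congr 1
    refine prod_congr rfl fun j _ => ?_
    rw [show n + (j + 1) = n + 1 + j by ring]
  rw [h]
  linear_combination (1 - q ^ (n + 1)) * pochhammerRatio q v (n + 1) m * hv n

theorem pochhammerRatio_zero_mul (hv : ∀ j, (1 + q ^ (j + 1)) * v j = 1) (m : ℕ) :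
    pochhammerRatio q v 0 m * ∏ j ∈ range m, (1 + q ^ (j + 1)) =
      ∏ j ∈ range m, (1 - q ^ (j + 1)) := by
  rw [pochhammerRatio, ← prod_mul_distrib]
  refine prod_congr rfl fun j _ => ?_
  rw [zero_add]
  linear_combination (1 - q ^ (j + 1)) * hv j

/-- The left side is the `n`-th telescoping term plus a multiple of `(1 - q^(n+m+1)) pochhammerRatio
q v n m`; the first ratio rule raises `m` there. The part this leaves over on the right carries `(1
+ q^(n+1)) pochhammerRatio q v n (m+1)`, which the second rule turns into the telescoping term for
`n + 1`. -/
theorem andrewsTerm_recurrence (hv : ∀ j, (1 + q ^ (j + 1)) * v j = 1) (i l m n : ℕ) :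
    andrewsTerm q v (i + 1 + l) (i + 1) m n - andrewsTerm q v (i + 1 + l) i m n =
      q ^ ((m + 1) * i) * (andrewsTerm q v (i + 1 + l) (l + 1) (m + 1) n +
        q ^ (m + 1) * andrewsTerm q v (i + 1 + l) l (m + 1) n) +
      ((-1) ^ n * q ^ (m * (i + 1 + l) * n + (i + 1 + l) * n ^ 2 + l * n) * (1 - q ^ n) *
        pochhammerRatio q v n m -
      (-1) ^ (n + 1) * q ^ (m * (i + 1 + l) * (n + 1) + (i + 1 + l) * (n + 1) ^ 2 + l * (n + 1)) *
        (1 - q ^ (n + 1)) * pochhammerRatio q v (n + 1) m) := by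
  have h1 := pochhammerRatio_succ_right hv n m
  have h2 := pochhammerRatio_succ_left hv n m
  simp only [andrewsTerm]
  rw [show i + 1 + l - (i + 1) = l by omega, show i + 1 + l - i = l + 1 by omega,
    show i + 1 + l - (l + 1) = i by omega, show i + 1 + l - l = i + 1 by omega]
  linear_combination
    (-(-1) ^ n * q ^ (m * (i + 1 + l) * n + (i + 1 + l) * n ^ 2 + l * n) *
      q ^ (n + (2 * n + 1 + m) * i)) * h1 +
    ((-1) ^ n * q ^ (m * (i + 1 + l) * (n + 1) + (i + 1 + l) * (n + 1) ^ 2 + l * (n + 1))) * h2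

/-- The recurrence for the partial sums of Andrews' series, modulo a power of `q`. -/
theorem sum_andrewsTerm_recurrence (hv : ∀ j, (1 + q ^ (j + 1)) * v j = 1) {N : ℕ}
    (hq : q ^ N = 0) (i l m : ℕ) :
    ∑ n ∈ range N, andrewsTerm q v (i + 1 + l) (i + 1) m n =
      ∑ n ∈ range N, andrewsTerm q v (i + 1 + l) i m n +
      q ^ ((m + 1) * i) * (∑ n ∈ range N, andrewsTerm q v (i + 1 + l) (l + 1) (m + 1) n +
        q ^ (m + 1) * ∑ n ∈ range N, andrewsTerm q v (i + 1 + l) l (m + 1) n) := by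
  rw [← sub_eq_iff_eq_add', ← sum_sub_distrib,
    sum_congr rfl fun n _ => andrewsTerm_recurrence hv i l m n, sum_add_distrib,
    sum_range_sub' (fun n => (-1) ^ n *
      q ^ (m * (i + 1 + l) * n + (i + 1 + l) * n ^ 2 + l * n) * (1 - q ^ n) *
        pochhammerRatio q v n m), ← mul_sum, sum_add_distrib, ← mul_sum]
  -- The upper end of the telescoped sum dies because its exponent is at least `N² ≥ N`; the lower
  -- end carries `1 - q^0`.
  have h : q ^ (m * (i + 1 + l) * N + (i + 1 + l) * N ^ 2 + l * N) = 0 := by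
    refine pow_eq_zero_of_le ?_ hq
    nlinarith [Nat.zero_le (m * (i + 1 + l) * N), Nat.zero_le (l * N),
      Nat.le_self_pow two_ne_zero N, Nat.zero_le ((i + l) * N ^ 2)]
  simp only [h, pow_zero, sub_self, mul_zero, zero_mul, add_zero]

/-- A family that satisfies the recurrence of Andrews' functions and is eventually `1` is
proportional to it. -/
theorem mul_eq_sum_andrewsTerm (hv : ∀ j, (1 + q ^ (j + 1)) * v j = 1) {N L k : ℕ}
    (hq : q ^ N = 0) (hNL : N ≤ L) (hN : 0 < N) (g : ℕ → ℕ → R) (g_zero : ∀ m, g 0 m = 0)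
    (g_last : ∀ i, 1 ≤ i → g i L = 1)
    (g_rec : ∀ i l m, i + 1 + l = k → g (i + 1) m = g i m +
      q ^ ((m + 1) * i) * (g (l + 1) (m + 1) + q ^ (m + 1) * g l (m + 1)))
    {i : ℕ} (hik : i ≤ k) :
    pochhammerRatio q v 0 L * g i 0 = ∑ n ∈ range N, andrewsTerm q v k i 0 n := by
  -- Downward induction on the level `m = L - a`, with an inner induction on `i`: the recurrence
  -- expresses `(i + 1, m)` through `(i, m)` and level `m + 1`.
  suffices H : ∀ a ≤ L, ∀ i ≤ k, pochhammerRatio q v 0 L * g i (L - a) =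
      ∑ n ∈ range N, andrewsTerm q v k i (L - a) n by
    simpa using H L le_rfl i hik
  have h0 : ∀ m, ∑ n ∈ range N, andrewsTerm q v k 0 m n = 0 := fun m => by simp [andrewsTerm]
  intro a
  induction a with
  | zero =>
    intro _ i hi
    rcases Nat.eq_zero_or_pos i with rfl | hi0
    · simp [h0, g_zero]
    -- At level `L` only `n = 0` survives, and its factor `1 - q^((1+L)i)` is `1`. This is where the
    -- constant of proportionality comes from.
    · rw [tsub_zero, g_last i hi0, mul_one, sum_eq_single 0]
      · have : q ^ ((2 * 0 + 1 + L) * i) = 0 :=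
          pow_eq_zero_of_le (by nlinarith) hq
        simp [andrewsTerm] at this ⊢
        simp [this]
      · intro n _ hn
        have : q ^ (L * k * n + k * n ^ 2 + (k - i) * n) = 0 := by
          refine pow_eq_zero_of_le ?_ hq
          have : 1 ≤ k * n := Nat.mul_pos (by omega) (by omega)
          nlinarith
        simp [andrewsTerm, this]
      · simp [hN.ne']
  | succ a ih =>
    intro ha i hi
    have ih := ih (by omega)
    obtain ⟨m, hm⟩ : ∃ m, L = m + (a + 1) := ⟨L - (a + 1), by omega⟩
    rw [show L - a = m + 1 by omega] at ih
    rw [show L - (a + 1) = m by omega]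
    induction i with
    | zero => simp [h0, g_zero]
    | succ i ihi =>
      obtain ⟨l, rfl⟩ : ∃ l, k = i + 1 + l := ⟨k - (i + 1), by omega⟩
      rw [sum_andrewsTerm_recurrence hv hq, ← ih (l + 1) (by omega), ← ih l (by omega),
        ← ihi (by omega), g_rec i l m rfl]
      ring

end ThetaRecurrence

/-! ### Gaussian binomials and the finite triple product. -/

section TripleProduct

variable {R : Type*} [CommRing R]

/-- The `q`-Pochhammer symbol `(s; s)_n`. -/
def pochhammerSelf (s : R) (n : ℕ) : R := ∏ j ∈ range n, (1 - s ^ (j + 1))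

theorem pochhammerSelf_succ (s : R) (n : ℕ) :
    pochhammerSelf s (n + 1) = pochhammerSelf s n * (1 - s ^ (n + 1)) :=
  prod_range_succ _ _

theorem pow_succ_dvd_pochhammerSelf_sub (s : R) (a b : ℕ) :
    s ^ (a + 1) ∣ pochhammerSelf s (a + b) - pochhammerSelf s a := by
  induction b with
  | zero => simp
  | succ b ih =>
    rw [← add_assoc, pochhammerSelf_succ]
    have h : s ^ (a + 1) ∣ s ^ (a + b + 1) := pow_dvd_pow s (by omega)
    convert dvd_sub ih (h.mul_left (pochhammerSelf s (a + b))) using 1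
    ring

/-- The Gaussian binomial coefficient `[u + v; u]`, where `y` is the inverse of the `q`-Pochhammer
symbol. -/
def gaussBinomial (s : R) (y : ℕ → R) (u v : ℕ) : R := pochhammerSelf s (u + v) * y u * y v

variable {s : R} {y : ℕ → R}

theorem inv_pochhammerSelf_eq (hy : ∀ n, pochhammerSelf s n * y n = 1) (n : ℕ) :
    y n = (1 - s ^ (n + 1)) * y (n + 1) := by
  have h := hy (n + 1)
  rw [pochhammerSelf_succ] at h
  linear_combination (-y n) * h + (1 - s ^ (n + 1)) * y (n + 1) * hy n

theorem gaussBinomial_comm (u v : ℕ) : gaussBinomial s y u v = gaussBinomial s y v u := by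
  rw [gaussBinomial, gaussBinomial, add_comm]
  ring

theorem gaussBinomial_succ_succ (hy : ∀ n, pochhammerSelf s n * y n = 1) (u v : ℕ) :
    gaussBinomial s y (u + 1) (v + 1) =
      gaussBinomial s y u (v + 1) + s ^ (u + 1) * gaussBinomial s y (u + 1) v := by
  simp only [gaussBinomial]
  rw [inv_pochhammerSelf_eq hy u, inv_pochhammerSelf_eq hy v,
    show u + 1 + (v + 1) = (u + 1 + v) + 1 by ring, show u + (v + 1) = u + 1 + v by ring,
    pochhammerSelf_succ]
  ring

theorem gaussBinomial_zero_left (hy : ∀ n, pochhammerSelf s n * y n = 1) (v : ℕ) :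
    gaussBinomial s y 0 v = 1 := by
  have h := hy 0
  rw [pochhammerSelf, range_zero, prod_empty, one_mul] at h
  rw [gaussBinomial, h, zero_add, mul_one, hy]

theorem gaussBinomial_zero_right (hy : ∀ n, pochhammerSelf s n * y n = 1) (u : ℕ) :
    gaussBinomial s y u 0 = 1 := by
  rw [gaussBinomial_comm, gaussBinomial_zero_left hy]

/-- Pascal's rule on the interior terms, reindexed so that the shifts fall on `f`. This and its
mirror image below together perform the step from `2N` to `2N + 2` in the triple product, each
releasing one linear factor. -/
theorem sum_antidiagonal_gaussBinomial_succ (hy : ∀ n, pochhammerSelf s n * y n = 1)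
    (f : ℕ → ℕ → R) (M : ℕ) :
    ∑ p ∈ antidiagonal (M + 1), f p.1 p.2 * gaussBinomial s y p.1 p.2 =
      ∑ p ∈ antidiagonal M, (f (p.1 + 1) p.2 + s ^ p.1 * f p.1 (p.2 + 1)) *
        gaussBinomial s y p.1 p.2 := by
  simp only [add_mul, sum_add_distrib]
  cases M with
  | zero =>
    simp [Nat.sum_antidiagonal_succ, gaussBinomial_zero_left hy, gaussBinomial_zero_right hy]
    ring
  | succ M =>
    rw [Nat.sum_antidiagonal_succ, Nat.sum_antidiagonal_succ']
    rw [Nat.sum_antidiagonal_succ' (n := M), Nat.sum_antidiagonal_succ (n := M)]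
    simp only [gaussBinomial_succ_succ hy, mul_add, sum_add_distrib, gaussBinomial_zero_left hy,
      gaussBinomial_zero_right hy]
    have h : ∀ p : ℕ × ℕ, f (p.1 + 1) (p.2 + 1) * (s ^ (p.1 + 1) * gaussBinomial s y (p.1 + 1) p.2)
      = s ^ (p.1 + 1) * f (p.1 + 1) (p.2 + 1) * gaussBinomial s y (p.1 + 1) p.2 :=
      fun p => by ring
    simp only [h]
    ring

theorem sum_antidiagonal_gaussBinomial_succ' (hy : ∀ n, pochhammerSelf s n * y n = 1)
    (f : ℕ → ℕ → R) (M : ℕ) :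
    ∑ p ∈ antidiagonal (M + 1), f p.1 p.2 * gaussBinomial s y p.1 p.2 =
      ∑ p ∈ antidiagonal M, (f p.1 (p.2 + 1) + s ^ p.2 * f (p.1 + 1) p.2) *
        gaussBinomial s y p.1 p.2 := by
  rw [← Nat.sum_antidiagonal_swap, ← Nat.sum_antidiagonal_swap (n := M)]
  have h := sum_antidiagonal_gaussBinomial_succ hy (fun u v => f v u) M
  simpa only [Prod.fst_swap, Prod.snd_swap, gaussBinomial_comm] using h

/-- The finite form of Jacobi's triple product identity. -/
theorem prod_mul_prod_eq_sum_gaussBinomial (hy : ∀ n, pochhammerSelf s n * y n = 1) {a b : R}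
    {w : ℤ → R} (w_zero : w 0 = 1)
    (w_succ : ∀ (n : ℤ) (r u : ℕ), (u : ℤ) = r - n → w (n + 1) * s ^ u = -(a * s ^ r * w n))
    (w_pred : ∀ (n : ℤ) (r u : ℕ), (u : ℤ) = r + n → w (n - 1) * s ^ u = -(b * s ^ r * w n))
    (N : ℕ) :
    (∏ j ∈ range N, (1 - a * s ^ j)) * ∏ j ∈ range N, (1 - b * s ^ j) =
      ∑ p ∈ antidiagonal (N + N), w (p.2 - N) * gaussBinomial s y p.1 p.2 := by
  induction N with
  | zero => simp [gaussBinomial_zero_left hy, w_zero]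
  | succ N ih =>
    rw [prod_range_succ, prod_range_succ, show N + 1 + (N + 1) = N + N + 1 + 1 by ring,
      sum_antidiagonal_gaussBinomial_succ' hy (fun _ v => w (v - (N + 1 : ℕ)))]
    have h1 : ∀ p ∈ antidiagonal (N + N + 1), (w ((p.2 + 1 : ℕ) - (N + 1 : ℕ)) +
        s ^ p.2 * w (p.2 - (N + 1 : ℕ))) * gaussBinomial s y p.1 p.2 =
        (1 - b * s ^ N) * (w (p.2 - N) * gaussBinomial s y p.1 p.2) := by
      intro p _
      have h := w_pred (p.2 - N) N p.2 (by ring)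
      rw [show (p.2 : ℤ) - N - 1 = p.2 - (N + 1 : ℕ) by push_cast; ring] at h
      rw [show ((p.2 + 1 : ℕ) : ℤ) - (N + 1 : ℕ) = p.2 - N by push_cast; ring]
      linear_combination gaussBinomial s y p.1 p.2 * h
    rw [sum_congr rfl h1, ← mul_sum,
      sum_antidiagonal_gaussBinomial_succ hy (fun _ v => w (v - N))]
    have h2 : ∀ p ∈ antidiagonal (N + N), (w (p.2 - N) + s ^ p.1 * w ((p.2 + 1 : ℕ) - N)) *
        gaussBinomial s y p.1 p.2 =
        (1 - a * s ^ N) * (w (p.2 - N) * gaussBinomial s y p.1 p.2) := by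
      intro p hp
      have hp' := HasAntidiagonal.mem_antidiagonal.mp hp
      have h := w_succ (p.2 - N) N p.1 (by omega)
      rw [show (p.2 : ℤ) - N + 1 = (p.2 + 1 : ℕ) - N by push_cast; ring] at h
      linear_combination gaussBinomial s y p.1 p.2 * h
    rw [sum_congr rfl h2, ← mul_sum, ← ih]
    ring

/-- All `(s; s)_n` with `n ≥ e` agree modulo `s^(e+1)`, so the two such factors in the numerator
cancel the two in the denominator. -/
theorem pow_dvd_gaussBinomial_mul_sub_one (hy : ∀ n, pochhammerSelf s n * y n = 1) {e u v N : ℕ}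
    (heN : e ≤ N) (hu : e ≤ u) (hv : e ≤ v) :
    s ^ (e + 1) ∣ gaussBinomial s y u v * pochhammerSelf s N - 1 := by
  have key : ∀ n, e ≤ n → s ^ (e + 1) ∣ pochhammerSelf s n - pochhammerSelf s e := fun n hn => by
    obtain ⟨d, rfl⟩ := Nat.exists_eq_add_of_le hn
    exact pow_succ_dvd_pochhammerSelf_sub s e d
  have h1 : s ^ (e + 1) ∣ pochhammerSelf s (u + v) - pochhammerSelf s u := by
    simpa using dvd_sub (key (u + v) (by omega)) (key u hu)
  have h2 : s ^ (e + 1) ∣ pochhammerSelf s N - pochhammerSelf s v := by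
    simpa using dvd_sub (key N heN) (key v hv)
  convert dvd_add (h1.mul_left (y u * y v * pochhammerSelf s N)) (h2.mul_left (y v)) using 1
  rw [gaussBinomial]
  linear_combination (y v * pochhammerSelf s N) * hy u + hy v

end TripleProduct

/-! ### The theta series and the triple product modulo a power of `q`. -/

section Theta

variable {R : Type*} [CommRing R]

/-- The term `(-1)^n q^{k n² - l n}` of the theta series. -/
def thetaTerm (q : R) (k l : ℕ) (n : ℤ) : R :=
  (((-1) ^ n : Rˣ) : R) * q ^ (k * n ^ 2 - l * n).toNat

theorem theta_exponent_nonneg {k l : ℕ} (hlk : l ≤ k) (n : ℤ) :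
    0 ≤ (k : ℤ) * n ^ 2 - l * n := by
  have h : (l : ℤ) ≤ k := by exact_mod_cast hlk
  have h0 : (0 : ℤ) ≤ l := by positivity
  rcases le_or_gt n 0 with hn | hn
  · nlinarith [mul_nonneg (h0.trans h) (sq_nonneg n)]
  · nlinarith [mul_nonneg (h0.trans h) (mul_nonneg hn.le (show 0 ≤ n - 1 by linarith))]

theorem thetaTerm_zero (q : R) (k l : ℕ) : thetaTerm q k l 0 = 1 := by simp [thetaTerm]

/-- Consecutive terms have ratio `-q^(k-l) q^(2kn)`. Since `n` may be negative and `q` need not be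
invertible, the ratio is stated with powers `r` and `u = r - n` on the two sides. -/
theorem thetaTerm_succ (q : R) {k l : ℕ} (hlk : l ≤ k) (n : ℤ) (r u : ℕ) (hu : (u : ℤ) = r - n) :
    thetaTerm q k l (n + 1) * (q ^ (2 * k)) ^ u =
      -(q ^ (k - l) * (q ^ (2 * k)) ^ r * thetaTerm q k l n) := by
  have h0 := theta_exponent_nonneg hlk n
  have h1 := theta_exponent_nonneg hlk (n + 1)
  have he : ((k : ℤ) * (n + 1) ^ 2 - l * (n + 1)).toNat + 2 * k * u =
      k - l + 2 * k * r + ((k : ℤ) * n ^ 2 - l * n).toNat := by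
    zify [hlk]
    rw [Int.toNat_of_nonneg h0, Int.toNat_of_nonneg h1, hu]
    ring
  have h := congrArg (q ^ ·) he
  simp only [pow_add] at h
  simp only [thetaTerm, zpow_add_one, ← pow_mul, Units.val_mul, Units.val_neg, Units.val_one]
  linear_combination (-(((-1) ^ n : Rˣ) : R)) * h

theorem thetaTerm_neg (q : R) (k l : ℕ) (n : ℤ) :
    thetaTerm q k l (-n) = (((-1) ^ n : Rˣ) : R) * q ^ (k * n ^ 2 + l * n).toNat := by
  rw [thetaTerm, zpow_neg, ← inv_zpow, inv_neg_one]
  congr 3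
  ring

theorem thetaTerm_pred (q : R) {k l : ℕ} (hlk : l ≤ k) (n : ℤ) (r u : ℕ) (hu : (u : ℤ) = r + n) :
    thetaTerm q k l (n - 1) * (q ^ (2 * k)) ^ u =
      -(q ^ (k + l) * (q ^ (2 * k)) ^ r * thetaTerm q k l n) := by
  have h0 := theta_exponent_nonneg hlk n
  have h1 := theta_exponent_nonneg hlk (n - 1)
  have he : ((k : ℤ) * (n - 1) ^ 2 - l * (n - 1)).toNat + 2 * k * u =
      k + l + 2 * k * r + ((k : ℤ) * n ^ 2 - l * n).toNat := by
    zify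
    rw [Int.toNat_of_nonneg h0, Int.toNat_of_nonneg h1, hu]
    ring
  have h := congrArg (q ^ ·) he
  simp only [pow_add] at h
  simp only [thetaTerm, zpow_sub_one, ← pow_mul, inv_neg_one, Units.val_mul, Units.val_neg,
    Units.val_one]
  linear_combination (-(((-1) ^ n : Rˣ) : R)) * h

/-- The indices `-n` and `n + 1` are paired since they supply the two monomials of `q^(kn²+ln) (1 -
q^((2n+1)(k-l)))`. -/
theorem sum_range_two_mul_add_one_eq (w : ℤ → R) (N : ℕ) :
    ∑ v ∈ range (N + N + 1), w (v - N) =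
      ∑ n ∈ range N, (w (-n) + w (n + 1)) + w (-N) := by
  induction N with
  | zero => simp
  | succ N ih =>
    rw [show N + 1 + (N + 1) + 1 = N + N + 1 + 1 + 1 by ring, sum_range_succ', sum_range_succ,
      sum_range_succ _ N]
    have h : ∀ v : ℕ, ((v + 1 : ℕ) : ℤ) - (N + 1 : ℕ) = v - N := fun v => by push_cast; ring
    simp only [h]
    rw [ih]
    push_cast
    rw [show (N : ℤ) + N + 1 - N = N + 1 by ring, zero_sub]
    ring

/-- Jacobi's triple product identity modulo a power of `q`. -/
theorem triple_product_eq_sum {q : R} {y : ℕ → R} {k l N : ℕ} (hk : 0 < k) (hlk : l ≤ k)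
    (hy : ∀ n, pochhammerSelf (q ^ (2 * k)) n * y n = 1) (hq : q ^ N = 0) :
    (∏ j ∈ range N, (1 - q ^ (k - l) * (q ^ (2 * k)) ^ j)) *
      (∏ j ∈ range N, (1 - q ^ (k + l) * (q ^ (2 * k)) ^ j)) * pochhammerSelf (q ^ (2 * k)) N =
      ∑ n ∈ range N, (-1) ^ n * q ^ (k * n ^ 2 + l * n) * (1 - q ^ ((2 * n + 1) * (k - l))) := by
  rw [prod_mul_prod_eq_sum_gaussBinomial hy (thetaTerm_zero q k l)
    (thetaTerm_succ q hlk) (thetaTerm_pred q hlk), sum_mul]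
  have h1 : ∀ p ∈ antidiagonal (N + N), thetaTerm q k l (p.2 - N) *
      gaussBinomial (q ^ (2 * k)) y p.1 p.2 * pochhammerSelf (q ^ (2 * k)) N =
      thetaTerm q k l (p.2 - N) := by
    rintro ⟨u, v⟩ huv
    rw [HasAntidiagonal.mem_antidiagonal] at huv
    simp only at huv ⊢
    have hd : (q ^ (2 * k)) ^ (min u v + 1) ∣
        gaussBinomial (q ^ (2 * k)) y u v * pochhammerSelf (q ^ (2 * k)) N - 1 :=
      pow_dvd_gaussBinomial_mul_sub_one hy (by omega) (by omega) (by omega)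
    obtain ⟨c, hc⟩ := hd
    -- Far from the centre the binomial is a poor approximation, but there the theta exponent is
    -- large. For `v = N + d` the total exponent is at least `k((d-1)(d-2) + 2N)`; for `v = N - d`
    -- it is `kd² + ld + 2k(v+1) ≥ v + d = N`.
    have hz : q ^ ((k : ℤ) * (v - N) ^ 2 - l * (v - N)).toNat * (q ^ (2 * k)) ^ (min u v + 1)
        = 0 := by
      rw [← pow_mul, ← pow_add]
      refine pow_eq_zero_of_le ?_ hq
      have h0 := theta_exponent_nonneg hlk (v - N)
      zify
      rw [Int.toNat_of_nonneg h0]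
      have hlk' : (l : ℤ) ≤ k := by exact_mod_cast hlk
      have hk' : (1 : ℤ) ≤ k := by exact_mod_cast hk
      have hl0 : (0 : ℤ) ≤ l := by positivity
      have huv' : (u : ℤ) + v = N + N := by exact_mod_cast huv
      rcases le_total u v with h | h
      · rw [min_eq_left (by exact_mod_cast h)]
        obtain ⟨d, hd⟩ : ∃ d : ℕ, v = N + d := ⟨v - N, by omega⟩
        have hdN : (u : ℤ) = N - d := by rw [hd] at huv'; push_cast at huv'; linarith
        rw [hd, hdN]
        push_cast
        rw [show (N : ℤ) + d - N = d by ring]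
        have h3 : (0 : ℤ) ≤ (d - 1) * (d - 2) := by
          rcases d with _ | _ | d
          · simp
          · simp
          · push_cast
            nlinarith
        have h4 : (0 : ℤ) ≤ N - d := by rw [← hdN]; positivity
        nlinarith [mul_nonneg (sub_nonneg.mpr hlk') (show (0 : ℤ) ≤ d by positivity),
          mul_nonneg (hl0.trans hlk') h3,
          mul_nonneg (sub_nonneg.mpr hk') (show (0 : ℤ) ≤ N by positivity)]
      · rw [min_eq_right (by exact_mod_cast h)]
        obtain ⟨d, hd⟩ : ∃ d : ℕ, N = v + d := ⟨N - v, by omega⟩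
        rw [hd]
        push_cast
        rw [show (v : ℤ) - (v + d) = -d by ring]
        have h3 : (0 : ℤ) ≤ d * (d - 1) := by
          rcases d with _ | d
          · simp
          · rw [Nat.cast_succ, add_sub_cancel_right]; positivity
        have hd0 : (0 : ℤ) ≤ d := by positivity
        have hv0 : (0 : ℤ) ≤ v := by positivity
        nlinarith [mul_nonneg hl0 hd0, mul_nonneg (sub_nonneg.mpr hk') hv0,
          mul_nonneg (sub_nonneg.mpr hk') hd0, mul_nonneg (sub_nonneg.mpr hk') h3]
    rw [thetaTerm]
    linear_combination (((-1) ^ ((v : ℤ) - N) : Rˣ) : R) *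
      q ^ ((k : ℤ) * (v - N) ^ 2 - l * (v - N)).toNat * hc +
      (((-1) ^ ((v : ℤ) - N) : Rˣ) : R) * c * hz
  rw [sum_congr rfl h1, ← Nat.sum_antidiagonal_swap,
    Nat.sum_antidiagonal_eq_sum_range_succ_mk]
  simp only [Prod.swap_prod_mk]
  rw [sum_range_two_mul_add_one_eq]
  have hN : thetaTerm q k l (-N) = 0 := by
    rw [thetaTerm_neg, pow_eq_zero_of_le _ hq, mul_zero]
    norm_cast
    nlinarith [Nat.le_self_pow two_ne_zero N, Nat.zero_le (l * N), Nat.zero_le (N ^ 2)]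
  rw [hN, add_zero]
  refine sum_congr rfl fun n _ => ?_
  rw [thetaTerm_neg, thetaTerm, zpow_add_one]
  have h2 : ((k : ℤ) * n ^ 2 + l * n).toNat = k * n ^ 2 + l * n := by norm_cast
  have h3 : ((k : ℤ) * (n + 1) ^ 2 - l * (n + 1)).toNat =
      k * n ^ 2 + l * n + (2 * n + 1) * (k - l) := by
    zify [hlk]
    rw [Int.toNat_of_nonneg (theta_exponent_nonneg hlk (n + 1))]
    ring
  rw [h2, h3, pow_add _ (k * n ^ 2 + l * n)]
  simp
  ring

end Theta

/-! ### Overpartitions as multisets, and generating functions. -/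

open PowerSeries

namespace Overpartition

/-- The sum of the parts of a multiset of (possibly overlined) parts. -/
def weight (s : Multiset (ℕ × Bool)) : ℕ := (s.map Prod.fst).sum

theorem weight_add (s t : Multiset (ℕ × Bool)) : weight (s + t) = weight s + weight t := by
  simp [weight]

theorem count_coe (p : ℕ × Bool) (l : List (ℕ × Bool)) :
    (l : Multiset (ℕ × Bool)).count p = l.count p := by
  rw [Multiset.count, Multiset.coe_countP, List.count]
  exact List.countP_congr fun x _ => by simpa using eq_comm

/-- The multisets of parts of the overpartitions whose parts exceed `m`. -/
def partsAbove (m : ℕ) : Set (Multiset (ℕ × Bool)) :=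
  {s | (∀ p ∈ s, m < p.1) ∧ ∀ a, s.count (a, true) ≤ 1}

/-- Orders parts by decreasing size, overlined parts first. -/
def PartOrder (p q : ℕ × Bool) : Prop := q.1 < p.1 ∨ p.1 = q.1 ∧ (q.2 = true → p.2 = true)

instance : DecidableRel PartOrder := fun _ _ => by unfold PartOrder; infer_instance

instance : Std.Total PartOrder :=
  ⟨fun p q => by rcases p with ⟨a, _ | _⟩ <;> rcases q with ⟨b, _ | _⟩ <;> simp [PartOrder] <;> omega⟩

instance : IsTrans (ℕ × Bool) PartOrder :=
  ⟨fun p q r => by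
    rcases p with ⟨a, _ | _⟩ <;> rcases q with ⟨b, _ | _⟩ <;> rcases r with ⟨c, _ | _⟩ <;>
      simp [PartOrder] <;> omega⟩

instance : Std.Antisymm PartOrder :=
  ⟨fun p q => by
    rcases p with ⟨a, _ | _⟩ <;> rcases q with ⟨b, _ | _⟩ <;> simp [PartOrder] <;> omega⟩

variable {n : ℕ}

theorem pairwise_partOrder (o : Overpartition n) : o.parts.Pairwise PartOrder :=
  (o.sorted.and o.overlined_first).imp fun {p q} h => by
    rcases h.1.lt_or_eq with h1 | h1
    · exact Or.inl h1
    · exact Or.inr ⟨h1.symm, fun h2 => by simp [h.2 h1.symm] at h2⟩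

theorem coe_parts_injective :
    Function.Injective (fun o : Overpartition n => (o.parts : Multiset (ℕ × Bool))) := by
  intro o₁ o₂ h
  exact Overpartition.ext
    ((Multiset.coe_eq_coe.mp h).eq_of_pairwise' o₁.pairwise_partOrder o₂.pairwise_partOrder)

theorem coe_parts_mem (o : Overpartition n) :
    (o.parts : Multiset (ℕ × Bool)) ∈ partsAbove 0 := by
  refine ⟨fun p hp => o.pos p (by simpa using hp), fun a => ?_⟩
  rw [count_coe]
  by_contra! h
  have h1 := o.overlined_first.sublist (List.replicate_sublist_iff.mpr h)
  simp at h1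

theorem weight_coe_parts (o : Overpartition n) : weight (o.parts : Multiset (ℕ × Bool)) = n := by
  rw [weight, Multiset.map_coe, Multiset.sum_coe, o.sum_eq]

theorem exists_coe_parts_eq {s : Multiset (ℕ × Bool)} (hs : s ∈ partsAbove 0)
    (hn : weight s = n) : ∃ o : Overpartition n, (o.parts : Multiset (ℕ × Bool)) = s := by
  have hmem : ∀ p, p ∈ s.sort PartOrder ↔ p ∈ s := fun p => Multiset.mem_sort _
  have hsort : (s.sort PartOrder).Pairwise PartOrder := Multiset.pairwise_sort _ _
  refine ⟨⟨s.sort PartOrder, fun p hp => hs.1 p ((hmem p).mp hp),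
    hsort.imp fun {p q} h => by rcases h with h | h <;> omega, ?_, ?_⟩, Multiset.sort_eq _ _⟩
  · rw [List.pairwise_iff_forall_sublist] at hsort ⊢
    rintro ⟨a, x⟩ ⟨b, y⟩ hab h
    obtain rfl : a = b := h
    by_contra hy
    obtain rfl : y = true := by simpa using hy
    have hx := hsort hab
    simp only [PartOrder, lt_irrefl, false_or, true_and, forall_const] at hx
    subst hx
    have h1 : 2 ≤ (s.sort PartOrder).count (a, true) := List.replicate_sublist_iff.mp hab
    rw [← count_coe, Multiset.sort_eq] at h1
    have h2 := hs.2 a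
    omega
  · rw [← hn, weight]
    conv_rhs => rw [← Multiset.sort_eq s PartOrder, Multiset.map_coe, Multiset.sum_coe]

/-- Overpartitions are counted by their multisets of parts. -/
theorem card_eq_ncard (P : Overpartition n → Prop) (S : Set (Multiset (ℕ × Bool)))
    (hS : S ⊆ partsAbove 0)
    (h : ∀ o : Overpartition n, P o ↔ (o.parts : Multiset (ℕ × Bool)) ∈ S) :
    Nat.card {o // P o} = (S ∩ {s | weight s = n}).ncard := by
  have : S ∩ {s | weight s = n} =
      (fun o : Overpartition n => (o.parts : Multiset (ℕ × Bool))) '' {o | P o} := by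
    ext s
    constructor
    · rintro ⟨h1, h2⟩
      obtain ⟨o, rfl⟩ := exists_coe_parts_eq (hS h1) h2
      exact ⟨o, (h o).mpr h1, rfl⟩
    · rintro ⟨o, h1, rfl⟩
      exact ⟨(h o).mp h1, o.weight_coe_parts⟩
  rw [this, Set.ncard_image_of_injective _ coe_parts_injective]
  rfl

theorem finite_inter_weight {S : Set (Multiset (ℕ × Bool))} (hS : S ⊆ partsAbove 0) (n : ℕ) :
    (S ∩ {s | weight s = n}).Finite := by
  refine (Set.finite_range
    (fun o : Overpartition n => (o.parts : Multiset (ℕ × Bool)))).subset ?_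
  rintro s ⟨h1, h2⟩
  obtain ⟨o, rfl⟩ := exists_coe_parts_eq (hS h1) h2
  exact ⟨o, rfl⟩

theorem partsAbove_subset (m : ℕ) : partsAbove m ⊆ partsAbove 0 :=
  fun _ hs => ⟨fun p hp => (Nat.zero_le m).trans_lt (hs.1 p hp), hs.2⟩

/-- The generating function of a class of multisets of parts. -/
noncomputable def genFun (S : Set (Multiset (ℕ × Bool))) : ℤ⟦X⟧ :=
  PowerSeries.mk fun n => ((S ∩ {s | weight s = n}).ncard : ℤ)

theorem genFun_union {S T : Set (Multiset (ℕ × Bool))} (hS : S ⊆ partsAbove 0)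
    (hT : T ⊆ partsAbove 0) (hST : Disjoint S T) : genFun (S ∪ T) = genFun S + genFun T := by
  ext n
  rw [map_add, genFun, genFun, genFun, coeff_mk, coeff_mk, coeff_mk, Set.union_inter_distrib_right,
    Set.ncard_union_eq (hST.mono Set.inter_subset_left Set.inter_subset_left)
      (finite_inter_weight hS n) (finite_inter_weight hT n)]
  push_cast
  rfl

theorem genFun_empty : genFun ∅ = 0 := by
  ext n
  simp [genFun]

theorem genFun_image_add (S : Set (Multiset (ℕ × Bool))) (u : Multiset (ℕ × Bool)) :
    genFun ((· + u) '' S) = X ^ weight u * genFun S := by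
  ext n
  rw [coeff_X_pow_mul', genFun, genFun, coeff_mk]
  split_ifs with h
  · have : (· + u) '' S ∩ {s | weight s = n} =
        (· + u) '' (S ∩ {s | weight s = n - weight u}) := by
      ext s
      constructor
      · rintro ⟨⟨t, ht, rfl⟩, h2⟩
        refine ⟨t, ⟨ht, ?_⟩, rfl⟩
        have h2 : weight (t + u) = n := h2
        rw [weight_add] at h2
        change weight t = n - weight u
        omega
      · rintro ⟨t, ⟨ht, h2⟩, rfl⟩
        have h2 : weight t = n - weight u := h2
        refine ⟨⟨t, ht, rfl⟩, ?_⟩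
        change weight (t + u) = n
        rw [weight_add]
        omega
    rw [coeff_mk, this, Set.ncard_image_of_injective _ (add_left_injective u)]
  · have : (· + u) '' S ∩ {s | weight s = n} = ∅ := by
      rw [Set.eq_empty_iff_forall_notMem]
      rintro _ ⟨⟨t, ht, rfl⟩, h2⟩
      have h2 : weight (t + u) = n := h2
      rw [weight_add] at h2
      omega
    rw [this, Set.ncard_empty, Nat.cast_zero]

/-- A non-empty multiset of parts above `m` weighs more than `m`. This provides the boundary value
`1` at a high level. -/
theorem X_pow_dvd_genFun_sub_one {m : ℕ} {S : Set (Multiset (ℕ × Bool))} (hS : S ⊆ partsAbove m)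
    (h0 : 0 ∈ S) : (X : ℤ⟦X⟧) ^ (m + 1) ∣ genFun S - 1 := by
  rw [X_pow_dvd_iff]
  intro n hn
  rw [map_sub, genFun, coeff_mk, coeff_one, sub_eq_zero]
  have key : S ∩ {s | weight s = n} = if n = 0 then {0} else ∅ := by
    ext s
    constructor
    · rintro ⟨h1, h2⟩
      have h2 : weight s = n := h2
      have hs : s = 0 := by
        refine Multiset.eq_zero_of_forall_notMem fun p hp => ?_
        have h3 := (hS h1).1 p hp
        have h4 := Multiset.le_sum_of_mem (Multiset.mem_map_of_mem Prod.fst hp)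
        rw [weight] at h2
        omega
      subst hs
      simp [weight] at h2
      simp [← h2]
    · split_ifs with h
      · rintro rfl
        exact ⟨h0, by simp [weight, h]⟩
      · simp
  rw [key]
  split_ifs <;> simp

end Overpartition

/-! ### Removing the smallest parts: recurrences for the two kinds of classes. -/

namespace Overpartition

theorem count_eq_zero_of_mem_partsAbove {m : ℕ} {s : Multiset (ℕ × Bool)} (hs : s ∈ partsAbove m)
    {a : ℕ} (ha : a ≤ m) (b : Bool) : s.count (a, b) = 0 :=
  Multiset.count_eq_zero.mpr fun h => absurd (hs.1 _ h) (by simpa using ha)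

/-- The classes of multisets of parts larger than `m`, at most `i - 1` of them non-overlined parts
`m + 1`, that satisfy the difference condition. -/
def differenceClass (k i m : ℕ) : Set (Multiset (ℕ × Bool)) :=
  {s | s ∈ partsAbove m ∧ s.count (m + 1, false) < i ∧ ∀ l, m < l →
    s.count (l + 1, false) + s.count (l, false) + s.count (l, true) < k}

theorem differenceClass_subset (k i m : ℕ) : differenceClass k i m ⊆ partsAbove m :=
  fun _ hs => hs.1

theorem differenceClass_zero (k m : ℕ) : differenceClass k 0 m = ∅ := by
  ext s
  simp [differenceClass]

theorem zero_mem_differenceClass {k i : ℕ} (hi : 0 < i) (hk : 0 < k) (m : ℕ) :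
    0 ∈ differenceClass k i m := by
  simp [differenceClass, partsAbove, hi, hk]

/-- The multiset that consists of `i` non-overlined and `e` overlined parts `a`. -/
def block (a i e : ℕ) : Multiset (ℕ × Bool) :=
  Multiset.replicate i (a, false) + Multiset.replicate e (a, true)

theorem weight_block (a i e : ℕ) : weight (block a i e) = a * (i + e) := by
  simp [weight, block]
  ring

theorem count_block_of_ne {a l : ℕ} (h : l ≠ a) (i e : ℕ) (b : Bool) :
    (block a i e).count (l, b) = 0 := by
  simp [block, Multiset.count_replicate, h.symm]

theorem count_block_false (a i e : ℕ) : (block a i e).count (a, false) = i := by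
  simp [block, Multiset.count_replicate]

theorem count_block_true (a i e : ℕ) : (block a i e).count (a, true) = e := by
  simp [block, Multiset.count_replicate]

theorem add_block_mem_partsAbove {m : ℕ} {s : Multiset (ℕ × Bool)} (hs : s ∈ partsAbove (m + 1))
    (i : ℕ) {e : ℕ} (he : e ≤ 1) : s + block (m + 1) i e ∈ partsAbove m := by
  refine ⟨fun p hp => ?_, fun a => ?_⟩
  · rcases Multiset.mem_add.mp hp with h | h
    · exact (Nat.lt_succ_self m).trans (hs.1 p h)
    · rcases Multiset.mem_add.mp h with h | h <;> rw [Multiset.eq_of_mem_replicate h] <;>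
        exact Nat.lt_succ_self m
  · rw [Multiset.count_add]
    by_cases h : a = m + 1
    · subst h
      rwa [count_eq_zero_of_mem_partsAbove hs le_rfl, count_block_true, zero_add]
    · rw [count_block_of_ne h, add_zero]
      exact hs.2 a

/-- A multiset of parts larger than `m` splits into its parts `m + 1` and its larger parts. -/
theorem exists_eq_add_block {m : ℕ} {s : Multiset (ℕ × Bool)} (hs : s ∈ partsAbove m) :
    ∃ t ∈ partsAbove (m + 1),
      s = t + block (m + 1) (s.count (m + 1, false)) (s.count (m + 1, true)) := by
  refine ⟨s.filter fun p => p.1 ≠ m + 1, ⟨fun p hp => ?_, fun a => ?_⟩, ?_⟩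
  · rw [Multiset.mem_filter] at hp
    have := hs.1 p hp.1
    omega
  · exact (Multiset.count_le_of_le _ (Multiset.filter_le _ _)).trans (hs.2 a)
  · ext ⟨a, b⟩
    rw [Multiset.count_add, Multiset.count_filter]
    by_cases h : a = m + 1
    · subst h
      cases b
      · simp [count_block_false]
      · simp [count_block_true]
    · simp [h, count_block_of_ne h]

/-- The inequality at `l = m + 1` reads `t.count (m + 2, false) + i + e < k`, which is exactly the
initial condition of the next level. Truncated subtraction is harmless: the bound `0` gives an empty
class. -/
theorem add_block_mem_differenceClass_iff {k j i m e : ℕ} (he : e ≤ 1)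
    {t : Multiset (ℕ × Bool)} (ht : t ∈ partsAbove (m + 1)) :
    t + block (m + 1) i e ∈ differenceClass k j m ↔
      i < j ∧ t ∈ differenceClass k (k - i - e) (m + 1) := by
  have h0 : ∀ b, t.count (m + 1, b) = 0 := count_eq_zero_of_mem_partsAbove ht le_rfl
  simp only [differenceClass, Set.mem_ofPred_eq, add_block_mem_partsAbove ht i he, ht, true_and,
    Multiset.count_add, h0, count_block_false, zero_add]
  refine and_congr_right fun hij => ?_
  constructor
  · intro h
    constructor
    · have := h (m + 1) (Nat.lt_succ_self m)
      simp only [count_block_of_ne (show m + 1 + 1 ≠ m + 1 by omega), count_block_false,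
        count_block_true, h0] at this
      omega
    · intro l hl
      simpa [count_block_of_ne (show l ≠ m + 1 by omega),
        count_block_of_ne (show l + 1 ≠ m + 1 by omega)] using h l (by omega)
  · rintro ⟨h1, h2⟩ l hl
    by_cases hlm : l = m + 1
    · subst hlm
      simp only [count_block_of_ne (show m + 1 + 1 ≠ m + 1 by omega), count_block_false,
        count_block_true, h0]
      omega
    · simpa [count_block_of_ne hlm, count_block_of_ne (show l + 1 ≠ m + 1 by omega)] using
        h2 l (by omega)

theorem differenceClass_succ (k i m : ℕ) :
    differenceClass k (i + 1) m = differenceClass k i m ∪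
      ((· + block (m + 1) i 0) '' differenceClass k (k - i) (m + 1) ∪
        (· + block (m + 1) i 1) '' differenceClass k (k - i - 1) (m + 1)) := by
  ext s
  constructor
  · intro hs
    obtain ⟨t, ht, hst⟩ := exists_eq_add_block hs.1
    have he := hs.1.2 (m + 1)
    have hs' := hs
    rw [hst, add_block_mem_differenceClass_iff he ht] at hs'
    rcases (Nat.lt_succ_iff.mp hs'.1).lt_or_eq with h | h
    · refine Or.inl ?_
      rw [hst, add_block_mem_differenceClass_iff he ht]
      exact ⟨h, hs'.2⟩
    · rw [h] at hst hs'
      rcases Nat.le_one_iff_eq_zero_or_eq_one.mp he with h1 | h1 <;> rw [h1] at hst hs'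
      · exact Or.inr (Or.inl ⟨t, hs'.2, hst.symm⟩)
      · exact Or.inr (Or.inr ⟨t, hs'.2, hst.symm⟩)
  · rintro (hs | ⟨t, ht, rfl⟩ | ⟨t, ht, rfl⟩)
    · exact ⟨hs.1, hs.2.1.trans (Nat.lt_succ_self i), hs.2.2⟩
    · exact (add_block_mem_differenceClass_iff zero_le_one ht.1).mpr ⟨Nat.lt_succ_self i, ht⟩
    · exact (add_block_mem_differenceClass_iff le_rfl ht.1).mpr ⟨Nat.lt_succ_self i, ht⟩

theorem genFun_differenceClass_succ (i l m : ℕ) :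
    genFun (differenceClass (i + 1 + l) (i + 1) m) = genFun (differenceClass (i + 1 + l) i m) +
      X ^ ((m + 1) * i) * (genFun (differenceClass (i + 1 + l) (l + 1) (m + 1)) +
        X ^ (m + 1) * genFun (differenceClass (i + 1 + l) l (m + 1))) := by
  have hsub : ∀ j e, e ≤ 1 →
      (· + block (m + 1) i e) '' differenceClass (i + 1 + l) j (m + 1) ⊆ partsAbove 0 := by
    rintro j e he _ ⟨t, ht, rfl⟩
    exact partsAbove_subset m (add_block_mem_partsAbove ht.1 i he)
  have hcount : ∀ (t : Multiset (ℕ × Bool)) j, t ∈ differenceClass (i + 1 + l) j (m + 1) →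
      ∀ b, t.count (m + 1, b) = 0 :=
    fun t j ht => count_eq_zero_of_mem_partsAbove ht.1 le_rfl
  rw [differenceClass_succ, genFun_union, genFun_union, genFun_image_add,
    genFun_image_add, weight_block, weight_block, show i + 1 + l - i = l + 1 by omega,
    Nat.add_sub_cancel]
  · ring
  · exact hsub _ 0 zero_le_one
  · exact hsub _ 1 le_rfl
  · rw [Set.disjoint_left]
    rintro _ ⟨t, ht, rfl⟩ ⟨u, hu, h⟩
    have h := congrArg (Multiset.count (m + 1, true)) h
    simp [hcount t _ ht, hcount u _ hu, count_block_true] at h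
  · exact (differenceClass_subset _ _ _).trans (partsAbove_subset m)
  · exact Set.union_subset (hsub _ 0 zero_le_one) (hsub _ 1 le_rfl)
  · rw [Set.disjoint_left]
    rintro _ h (⟨t, ht, rfl⟩ | ⟨t, ht, rfl⟩)
    all_goals
      have h := h.2.1
      simp [hcount t _ ht, count_block_false] at h

/-- The class of multisets of parts larger than `m`, where the non-overlined parts satisfy `A` and
the overlined parts satisfy `B`. -/
def restrictedClass (A B : ℕ → Prop) (m : ℕ) : Set (Multiset (ℕ × Bool)) :=
  {s | s ∈ partsAbove m ∧ ∀ p ∈ s, if p.2 = true then B p.1 else A p.1}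

theorem restrictedClass_subset (A B : ℕ → Prop) (m : ℕ) : restrictedClass A B m ⊆ partsAbove m :=
  fun _ hs => hs.1

theorem zero_mem_restrictedClass (A B : ℕ → Prop) (m : ℕ) : 0 ∈ restrictedClass A B m := by
  simp [restrictedClass, partsAbove]

theorem mem_block {a i e : ℕ} {p : ℕ × Bool} :
    p ∈ block a i e ↔ (i ≠ 0 ∧ p = (a, false)) ∨ (e ≠ 0 ∧ p = (a, true)) := by
  simp [block, Multiset.mem_replicate]

theorem add_block_mem_restrictedClass_iff {A B : ℕ → Prop} {m i e : ℕ} (he : e ≤ 1)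
    {t : Multiset (ℕ × Bool)} (ht : t ∈ partsAbove (m + 1)) :
    t + block (m + 1) i e ∈ restrictedClass A B m ↔
      (i ≠ 0 → A (m + 1)) ∧ (e ≠ 0 → B (m + 1)) ∧ t ∈ restrictedClass A B (m + 1) := by
  simp only [restrictedClass, Set.mem_ofPred_eq, add_block_mem_partsAbove ht i he, ht, true_and,
    Multiset.mem_add, mem_block]
  constructor
  · intro h
    exact ⟨fun hi => by simpa using h (m + 1, false) (Or.inr (Or.inl ⟨hi, rfl⟩)),
      fun he => by simpa using h (m + 1, true) (Or.inr (Or.inr ⟨he, rfl⟩)),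
      fun p hp => h p (Or.inl hp)⟩
  · rintro ⟨h1, h2, h3⟩ p (hp | ⟨hp, rfl⟩ | ⟨hp, rfl⟩)
    · exact h3 p hp
    · simpa using h1 hp
    · simpa using h2 hp

/-- Peeling off the overlined part `m + 1`. -/
theorem genFun_restrictedClass_count_eq_zero (A B : ℕ → Prop) [DecidablePred B] (m : ℕ) :
    genFun {s ∈ restrictedClass A B m | s.count (m + 1, false) = 0} =
      (if B (m + 1) then 1 + X ^ (m + 1) else 1) * genFun (restrictedClass A B (m + 1)) := by
  have hcount : ∀ t ∈ restrictedClass A B (m + 1), ∀ b, t.count (m + 1, b) = 0 :=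
    fun t ht => count_eq_zero_of_mem_partsAbove ht.1 le_rfl
  have h1 : {s ∈ restrictedClass A B m | s.count (m + 1, false) = 0} =
      restrictedClass A B (m + 1) ∪
        {s | B (m + 1) ∧ s ∈ (· + block (m + 1) 0 1) '' restrictedClass A B (m + 1)} := by
    ext s
    constructor
    · rintro ⟨hs, h0⟩
      obtain ⟨t, ht, hst⟩ := exists_eq_add_block hs.1
      have he := hs.1.2 (m + 1)
      rw [hst, add_block_mem_restrictedClass_iff he ht] at hs
      rw [h0] at hst
      rcases Nat.le_one_iff_eq_zero_or_eq_one.mp he with h1 | h1 <;> rw [h1] at hst hs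
      · left
        simpa [hst, block] using hs.2.2
      · exact Or.inr ⟨hs.2.1 one_ne_zero, t, hs.2.2, hst.symm⟩
    · rintro (hs | ⟨hB, t, ht, rfl⟩)
      · refine ⟨?_, hcount s hs _⟩
        have := (add_block_mem_restrictedClass_iff (i := 0) zero_le_one hs.1).mpr
          ⟨by simp, by simp, hs⟩
        simpa [block] using this
      · refine ⟨(add_block_mem_restrictedClass_iff le_rfl ht.1).mpr
          ⟨by simp, fun _ => hB, ht⟩, ?_⟩
        simp [hcount t ht, count_block_false]
  have hsub : restrictedClass A B (m + 1) ⊆ partsAbove 0 :=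
    (restrictedClass_subset A B _).trans (partsAbove_subset _)
  rw [h1]
  split_ifs with hB
  · simp only [hB, true_and, Set.ofPred_mem_eq]
    rw [genFun_union hsub, genFun_image_add, weight_block]
    · ring
    · rintro _ ⟨t, ht, rfl⟩
      exact partsAbove_subset m (add_block_mem_partsAbove ht.1 0 le_rfl)
    · rw [Set.disjoint_left]
      rintro _ h ⟨t, ht, rfl⟩
      have h := hcount _ h true
      simp [count_block_true] at h
  · simp [hB]

/-- Peeling off the parts `m + 1`. -/
theorem genFun_restrictedClass_mul (A B : ℕ → Prop) [DecidablePred A] [DecidablePred B] (m : ℕ) :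
    genFun (restrictedClass A B m) * (if A (m + 1) then 1 - X ^ (m + 1) else 1) =
      (if B (m + 1) then 1 + X ^ (m + 1) else 1) * genFun (restrictedClass A B (m + 1)) := by
  rw [← genFun_restrictedClass_count_eq_zero]
  -- The geometric series in multiplied-out form: a member containing a non-overlined `m + 1` is any
  -- member with one more copy added.
  have h1 : restrictedClass A B m =
      {s ∈ restrictedClass A B m | s.count (m + 1, false) = 0} ∪
        {s | A (m + 1) ∧ s ∈ (· + {(m + 1, false)}) '' restrictedClass A B m} := by
    ext s
    constructor
    · intro hs
      by_cases h0 : s.count (m + 1, false) = 0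
      · exact Or.inl ⟨hs, h0⟩
      · have hmem : (m + 1, false) ∈ s := Multiset.count_ne_zero.mp h0
        refine Or.inr ⟨by simpa using hs.2 _ hmem, s.erase (m + 1, false), ⟨⟨fun p hp =>
          hs.1.1 p (Multiset.mem_of_mem_erase hp), fun a => ?_⟩, fun p hp =>
          hs.2 p (Multiset.mem_of_mem_erase hp)⟩, ?_⟩
        · exact (Multiset.count_le_of_le _ (Multiset.erase_le _ _)).trans (hs.1.2 a)
        · change s.erase (m + 1, false) + {(m + 1, false)} = s
          rw [add_comm, Multiset.singleton_add, Multiset.cons_erase hmem]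
    · rintro (⟨hs, -⟩ | ⟨hA, t, ht, rfl⟩)
      · exact hs
      · refine ⟨⟨fun p hp => ?_, fun a => ?_⟩, fun p hp => ?_⟩
        · rcases Multiset.mem_add.mp hp with h | h
          · exact ht.1.1 p h
          · rw [Multiset.mem_singleton.mp h]
            exact Nat.lt_succ_self m
        · simpa [Multiset.count_singleton] using ht.1.2 a
        · rcases Multiset.mem_add.mp hp with h | h
          · exact ht.2 p h
          · rw [Multiset.mem_singleton.mp h]
            simpa using hA
  have hsub : restrictedClass A B m ⊆ partsAbove 0 :=
    (restrictedClass_subset A B _).trans (partsAbove_subset _)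
  split_ifs with hA
  · have h2 := congrArg genFun h1
    simp only [hA, true_and, Set.ofPred_mem_eq] at h2
    rw [genFun_union ((Set.sep_subset _ _).trans hsub), genFun_image_add] at h2
    · have h3 : weight {(m + 1, false)} = m + 1 := by simp [weight]
      rw [h3] at h2
      linear_combination h2
    · rintro _ ⟨t, ht, rfl⟩
      refine hsub ?_
      rw [h1]
      exact Or.inr ⟨hA, t, ht, rfl⟩
    · rw [Set.disjoint_left]
      rintro _ h ⟨t, ht, rfl⟩
      have h := h.2
      simp at h
  · simp only [hA, false_and, Set.ofPred_false, Set.union_empty] at h1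
    rw [mul_one, ← h1]

theorem genFun_restrictedClass_mul_prod (A B : ℕ → Prop) [DecidablePred A] [DecidablePred B] (L : ℕ) :
    genFun (restrictedClass A B 0) *
        ∏ j ∈ Finset.range L, (if A (j + 1) then 1 - X ^ (j + 1) else 1) =
      (∏ j ∈ Finset.range L, (if B (j + 1) then 1 + X ^ (j + 1) else 1)) *
        genFun (restrictedClass A B L) := by
  induction L with
  | zero => simp
  | succ L ih =>
    rw [Finset.prod_range_succ, Finset.prod_range_succ, ← mul_assoc, ih, mul_assoc,
      genFun_restrictedClass_mul, mul_assoc]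

end Overpartition

/-! ### The difference condition in terms of multiplicities. -/

namespace Overpartition

variable {n : ℕ}

theorem count_add_count_add_count_eq_countP (a : ℕ) (l : List (ℕ × Bool)) :
    l.count (a + 1, false) + l.count (a, false) + l.count (a, true) =
      l.countP fun x => x = (a + 1, false) ∨ x.1 = a := by
  induction l with
  | nil => simp
  | cons x l ih =>
    rw [List.countP_cons, ← ih, List.count_cons, List.count_cons, List.count_cons]
    rcases x with ⟨b, _ | _⟩ <;> by_cases h1 : b = a <;> by_cases h2 : b = a + 1 <;>
      simp [h1, h2] <;> omega

/-- Among `k` such parts, let the first stand at position `j`. The `k`-th stands at `j + k - 1` or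
later, so `d_{j+k-1} ≥ a`, while `d_j` is either `a` or a non-overlined `a + 1`: the required gap
fails in both cases. -/
theorem countP_lt_of_differenceCondition {k i : ℕ} {o : Overpartition n}
    (h : o.DifferenceCondition k i) (hk : 0 < k) (a : ℕ) :
    o.parts.countP (fun x => x = (a + 1, false) ∨ x.1 = a) < k := by
  by_contra! hc
  rw [List.countP_eq_length_filter] at hc
  obtain ⟨f, hf⟩ := List.sublist_iff_exists_fin_orderEmbedding_get_eq.mp
    (List.filter_sublist (p := fun x => decide (x = (a + 1, false) ∨ x.1 = a)) (l := o.parts))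
  have hp : ∀ j, o.parts.get (f j) = (a + 1, false) ∨ (o.parts.get (f j)).1 = a := by
    intro j
    rw [← hf j]
    simpa using (List.mem_filter.mp (List.get_mem _ j)).2
  have hgrow : ∀ (b : ℕ) (hb : b < _), (f ⟨0, by omega⟩ : ℕ) + b ≤ f ⟨b, hb⟩ := by
    intro b
    induction b with
    | zero => intro hb; exact le_rfl
    | succ b ih =>
      intro hb
      have h1 := ih (by omega)
      have h2 : f ⟨b, by omega⟩ < f ⟨b + 1, hb⟩ := f.strictMono (by simp)
      have h2 : (f ⟨b, by omega⟩ : ℕ) < f ⟨b + 1, hb⟩ := h2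
      omega
  have h0 := hp ⟨0, by omega⟩
  have h1 := hp ⟨k - 1, by omega⟩
  have h2 := hgrow (k - 1) (by omega)
  set j := f ⟨0, by omega⟩
  set j' := f ⟨k - 1, by omega⟩
  have hlt : (j : ℕ) + (k - 1) < o.parts.length := h2.trans_lt j'.2
  have hle : o.parts[(j' : ℕ)].1 ≤ (o.parts[(j : ℕ) + (k - 1)]).1 := by
    rcases h2.lt_or_eq with h3 | h3
    · exact List.pairwise_iff_getElem.mp o.sorted _ _ hlt j'.2 h3
    · simp only [h3, le_refl]
  have hd := h.2 j hlt
  simp only [List.get_eq_getElem] at h0 h1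
  have h1' : a ≤ o.parts[(j' : ℕ)].1 := by
    rcases h1 with h1 | h1 <;> rw [h1]
    exact Nat.le_succ a
  rcases h0 with h0 | h0
  · rw [h0] at hd
    simp at hd
    omega
  · split_ifs at hd <;> omega

theorem differenceCondition_of_countP_lt {k i : ℕ} {o : Overpartition n} (hk : 0 < k)
    (h1 : o.parts.count (1, false) ≤ i - 1)
    (h : ∀ a, o.parts.countP (fun x => x = (a + 1, false) ∨ x.1 = a) < k) :
    o.DifferenceCondition k i := by
  refine ⟨h1, fun j hj => ?_⟩
  by_contra hc
  have hle : ∀ b (hb : b < o.parts.length), j ≤ b → o.parts[b].1 ≤ o.parts[j].1 ∧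
      (o.parts[j].2 = false → o.parts[b].1 = o.parts[j].1 → o.parts[b].2 = false) := by
    intro b hb hjb
    rcases hjb.lt_or_eq with h3 | rfl
    · exact ⟨List.pairwise_iff_getElem.mp o.sorted _ _ _ hb h3, fun _ h4 =>
        List.pairwise_iff_getElem.mp o.overlined_first _ _ _ hb h3 h4.symm⟩
    · exact ⟨le_rfl, fun h3 _ => h3⟩
  have hge : ∀ b (hb : b < o.parts.length), b ≤ j + (k - 1) →
      (o.parts[j + (k - 1)]).1 ≤ o.parts[b].1 := by
    intro b hb hjb
    rcases hjb.lt_or_eq with h3 | rfl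
    · exact List.pairwise_iff_getElem.mp o.sorted _ _ hb _ h3
    · exact le_rfl
  -- If the gap fails at `d_j`, the whole window of `k` parts is of the counted type: with `a = d_j`
  -- when `d_j` is overlined, and `a = d_j - 1` otherwise.
  obtain ⟨a, ha⟩ : ∃ a, ∀ b (hb : b < o.parts.length), j ≤ b → b ≤ j + (k - 1) →
      o.parts[b] = (a + 1, false) ∨ o.parts[b].1 = a := by
    by_cases hj2 : o.parts[j].2 = true
    · rw [if_pos hj2] at hc
      refine ⟨o.parts[j].1, fun b hb h3 h4 => Or.inr ?_⟩
      have := (hle b hb h3).1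
      have := hge b hb h4
      omega
    · rw [if_neg hj2] at hc
      have hpos := o.pos o.parts[j] (List.getElem_mem _)
      refine ⟨o.parts[j].1 - 1, fun b hb h3 h4 => ?_⟩
      obtain ⟨h5, h6⟩ := hle b hb h3
      have h7 := hge b hb h4
      rcases h5.lt_or_eq with h8 | h8
      · right
        omega
      · left
        refine Prod.ext ?_ (h6 (by simpa using hj2) h8)
        simp only
        omega
  refine (h a).not_ge ?_
  have hsub : ((o.parts.drop j).take k).Sublist o.parts :=
    (List.take_sublist _ _).trans (List.drop_sublist _ _)
  refine le_trans ?_ hsub.countP_le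
  have hlen : ((o.parts.drop j).take k).length = k := by
    rw [List.length_take, List.length_drop]
    omega
  rw [List.countP_eq_length.mpr, hlen]
  intro x hx
  obtain ⟨b, hb, rfl⟩ := List.getElem_of_mem hx
  rw [hlen] at hb
  simpa using ha (j + b) (by omega) (by omega) (by omega)

theorem differenceCondition_iff {k i : ℕ} (hi : 1 ≤ i) (hik : i ≤ k) (o : Overpartition n) :
    o.DifferenceCondition k i ↔
      (o.parts : Multiset (ℕ × Bool)) ∈ differenceClass k i 0 := by
  have key : ∀ a, (o.parts : Multiset (ℕ × Bool)).count (a + 1, false) +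
      (o.parts : Multiset (ℕ × Bool)).count (a, false) +
      (o.parts : Multiset (ℕ × Bool)).count (a, true) =
      o.parts.countP fun x => x = (a + 1, false) ∨ x.1 = a := fun a => by
    rw [count_coe, count_coe, count_coe, count_add_count_add_count_eq_countP]
  have h1 : (o.parts : Multiset (ℕ × Bool)).count (0 + 1, false) = o.parts.count (1, false) :=
    count_coe _ _
  constructor
  · intro h
    refine ⟨o.coe_parts_mem, ?_, fun l _ => ?_⟩
    · have := h.1
      omega
    · rw [key]
      exact countP_lt_of_differenceCondition h (by omega) l
  · rintro ⟨h, h2, h3⟩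
    refine differenceCondition_of_countP_lt (by omega) (by omega) fun a => ?_
    -- `a = 0` arises from a non-overlined `d_j = 1`. It is not covered by `differenceClass`, but
    -- follows from the bound on the ones and `i ≤ k`.
    rcases Nat.eq_zero_or_pos a with rfl | ha
    · rw [← key, count_eq_zero_of_mem_partsAbove h le_rfl, count_eq_zero_of_mem_partsAbove h le_rfl]
      omega
    · rw [← key]
      exact h3 a ha

theorem countD_eq_ncard {k i : ℕ} (hi : 1 ≤ i) (hik : i ≤ k) (n : ℕ) :
    countD k i n = (differenceClass k i 0 ∩ {s | weight s = n}).ncard :=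
  card_eq_ncard _ _ (differenceClass_subset _ _ _) (differenceCondition_iff hi hik)

theorem countC_self_eq_ncard (k n : ℕ) :
    countC k k n = (restrictedClass (fun a => ¬ k ∣ a) (fun a => ¬ k ∣ a) 0 ∩
      {s | weight s = n}).ncard := by
  refine card_eq_ncard _ _ (restrictedClass_subset _ _ _) fun o => ?_
  simp [CongruenceCondition, restrictedClass, o.coe_parts_mem]

theorem not_modEq_iff {k i : ℕ} (hi : 1 ≤ i) (hik : i < k) (a : ℕ) :
    (¬ (a : ℤ) ≡ 0 [ZMOD 2 * k] ∧ ¬ (a : ℤ) ≡ i [ZMOD 2 * k] ∧ ¬ (a : ℤ) ≡ -i [ZMOD 2 * k]) ↔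
      ¬ (a % (2 * k) = 0 ∨ a % (2 * k) = i ∨ a % (2 * k) = 2 * k - i) := by
  have h2 : (-i : ℤ) ≡ ((2 * k - i : ℕ) : ℤ) [ZMOD 2 * k] := by
    rw [Int.modEq_iff_dvd]
    refine ⟨1, ?_⟩
    push_cast [show i ≤ 2 * k by omega]
    ring
  have h3 : (a : ℤ) ≡ -i [ZMOD 2 * k] ↔ (a : ℤ) ≡ ((2 * k - i : ℕ) : ℤ) [ZMOD 2 * k] :=
    ⟨fun h => h.trans h2, fun h => h.trans h2.symm⟩
  have h4 : ∀ b : ℕ, b < 2 * k → ((a : ℤ) ≡ b [ZMOD 2 * k] ↔ a % (2 * k) = b) := by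
    intro b hb
    rw [show (2 * k : ℤ) = ((2 * k : ℕ) : ℤ) by push_cast; rfl, Int.natCast_modEq_iff, Nat.ModEq,
      Nat.mod_eq_of_lt hb]
  rw [h3, h4 i (by omega), h4 (2 * k - i) (by omega), ← Nat.cast_zero, h4 0 (by omega)]
  tauto

theorem countC_eq_ncard {k i : ℕ} (hi : 1 ≤ i) (hik : i < k) (n : ℕ) :
    countC k i n = (restrictedClass
      (fun a => ¬ (a % (2 * k) = 0 ∨ a % (2 * k) = i ∨ a % (2 * k) = 2 * k - i))
      (fun _ => True) 0 ∩ {s | weight s = n}).ncard := by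
  refine card_eq_ncard _ _ (restrictedClass_subset _ _ _) fun o => ?_
  rw [CongruenceCondition, if_neg hik.ne]
  simp only [not_modEq_iff hi hik, restrictedClass, Set.mem_ofPred_eq, o.coe_parts_mem, true_and,
    Multiset.mem_coe]
  refine forall₂_congr fun p _ => ?_
  rcases p with ⟨a, _ | _⟩ <;> simp

end Overpartition

/-! ### Finite product identities. -/

section Products

variable {R : Type*} [CommRing R]

theorem prod_range_mul_eq (f : ℕ → R) (c N : ℕ) :
    ∏ j ∈ range (c * N), f j = ∏ b ∈ range N, ∏ x ∈ range c, f (c * b + x) := by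
  induction N with
  | zero => simp
  | succ N ih => rw [Nat.mul_succ, prod_range_add, ih, prod_range_succ]

theorem prod_range_ite_dvd (f : ℕ → R) {k : ℕ} (hk : 0 < k) (N : ℕ) :
    ∏ j ∈ range (k * N), (if k ∣ j + 1 then f (j + 1) else 1) =
      ∏ b ∈ range N, f (k * (b + 1)) := by
  rw [prod_range_mul_eq]
  refine prod_congr rfl fun b _ => ?_
  have h : k * b + (k - 1) + 1 = k * (b + 1) := by rw [Nat.mul_succ]; omega
  rw [prod_eq_single (k - 1), h, if_pos (dvd_mul_right _ _)]
  · intro x hx hxk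
    rw [mem_range] at hx
    rw [if_neg]
    rw [add_assoc, Nat.dvd_add_right (dvd_mul_right _ _)]
    exact fun h => absurd (Nat.le_of_dvd (Nat.succ_pos x) h) (by omega)
  · intro h
    exact absurd (mem_range.mpr (by omega)) h

theorem prod_range_ite_mod (q : R) {k i : ℕ} (hi : 1 ≤ i) (hik : i < k) (N : ℕ) :
    ∏ j ∈ range (2 * k * N), (if (j + 1) % (2 * k) = 0 ∨ (j + 1) % (2 * k) = i ∨
        (j + 1) % (2 * k) = 2 * k - i then 1 - q ^ (j + 1) else 1) =
      (∏ b ∈ range N, (1 - q ^ i * (q ^ (2 * k)) ^ b)) *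
        (∏ b ∈ range N, (1 - q ^ (2 * k - i) * (q ^ (2 * k)) ^ b)) *
        ∏ b ∈ range N, (1 - (q ^ (2 * k)) ^ (b + 1)) := by
  rw [prod_range_mul_eq, ← prod_mul_distrib, ← prod_mul_distrib]
  refine prod_congr rfl fun b _ => ?_
  -- Each period of length `2k` contributes three factors, distinct because `1 ≤ i < k`.
  have hsub : ({i - 1, 2 * k - i - 1, 2 * k - 1} : Finset ℕ) ⊆ range (2 * k) := by
    intro x hx
    simp only [mem_insert, mem_singleton] at hx
    rw [mem_range]
    omega
  have hmod : ∀ x, (2 * k * b + x + 1) % (2 * k) = (x + 1) % (2 * k) := fun x => by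
    rw [add_assoc, Nat.mul_add_mod]
  simp only [hmod]
  rw [← prod_subset hsub, prod_insert, prod_insert, prod_singleton]
  · rw [Nat.sub_add_cancel hi, show 2 * k - i - 1 + 1 = 2 * k - i by omega,
      Nat.sub_add_cancel (show 1 ≤ 2 * k by omega), Nat.mod_self, Nat.mod_eq_of_lt (by omega),
      Nat.mod_eq_of_lt (by omega), if_pos (by simp), if_pos (by simp), if_pos (by simp),
      show 2 * k * b + (i - 1) + 1 = i + 2 * k * b by omega,
      show 2 * k * b + (2 * k - i - 1) + 1 = 2 * k - i + 2 * k * b by omega,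
      show 2 * k * b + (2 * k - 1) + 1 = 2 * k * (b + 1) by rw [Nat.mul_succ]; omega]
    rw [pow_add, pow_add, pow_mul, pow_mul]
    ring
  · simp only [mem_singleton]
    omega
  · simp only [mem_insert, mem_singleton]
    omega
  · intro x hx hx'
    rw [mem_range] at hx
    simp only [mem_insert, mem_singleton, not_or] at hx'
    rw [if_neg]
    rcases Nat.lt_or_ge (x + 1) (2 * k) with h | h
    · rw [Nat.mod_eq_of_lt h]
      omega
    · omega

/-- Euler's argument: `(-Q; Q)(Q; Q) = (Q²; Q²)` and `(Q; Q) = (Q; Q²)(Q²; Q²)`; cancel the unit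
`(Q²; Q²)`. -/
theorem prod_range_one_add_mul_odd {Q : R} {N : ℕ} (hQ : Q ^ N = 0) :
    (∏ b ∈ range (2 * N), (1 + Q ^ (b + 1))) * ∏ b ∈ range N, (1 - Q ^ (2 * b + 1)) = 1 := by
  have hsplit : ∏ b ∈ range (2 * N), (1 - Q ^ (b + 1)) =
      (∏ b ∈ range N, (1 - Q ^ (2 * b + 1))) * ∏ b ∈ range N, (1 - (Q ^ 2) ^ (b + 1)) := by
    rw [prod_range_mul_eq, ← prod_mul_distrib]
    refine prod_congr rfl fun b _ => ?_
    rw [prod_range_succ, prod_range_one, ← pow_mul]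
    rfl
  have hsq : (∏ b ∈ range (2 * N), (1 + Q ^ (b + 1))) * ∏ b ∈ range (2 * N), (1 - Q ^ (b + 1)) =
      ∏ b ∈ range N, (1 - (Q ^ 2) ^ (b + 1)) := by
    rw [← prod_mul_distrib, two_mul, prod_range_add]
    have h1 : ∀ b, (1 + Q ^ (N + b + 1)) * (1 - Q ^ (N + b + 1)) = 1 := fun b => by
      rw [pow_eq_zero_of_le (by omega) hQ]
      ring
    simp only [h1, prod_const_one, mul_one]
    exact prod_congr rfl fun b _ => by ring
  have hunit : IsUnit (∏ b ∈ range N, (1 - (Q ^ 2) ^ (b + 1))) := by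
    refine IsUnit.prod_iff.mpr fun b _ => IsNilpotent.isUnit_one_sub ⟨N, ?_⟩
    rw [← pow_mul, ← pow_mul]
    exact pow_eq_zero_of_le ((Nat.le_mul_of_pos_left N (Nat.succ_pos b)).trans
      (Nat.le_mul_of_pos_left _ two_pos)) hQ
  rw [hsplit] at hsq
  exact hunit.mul_right_cancel (by linear_combination hsq)

end Products

/-! ### Comparison of the two generating functions. -/

namespace Overpartition

/-- Modulo any power of `X` the two generating functions agree. -/
theorem map_genFun_eq {R : Type*} [CommRing R] (φ : ℤ⟦X⟧ →+* R) {N : ℕ} (hN : 0 < N)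
    (hφ : φ X ^ N = 0) {k i : ℕ} (hi : 1 ≤ i) (hik : i ≤ k) {A B : ℕ → Prop}
    (hAB : i = k ∧ A = (fun a => ¬ k ∣ a) ∧ B = (fun a => ¬ k ∣ a) ∨
      i < k ∧ A = (fun a => ¬ (a % (2 * k) = 0 ∨ a % (2 * k) = i ∨ a % (2 * k) = 2 * k - i)) ∧
        B = fun _ => True) :
    φ (genFun (restrictedClass A B 0)) = φ (genFun (differenceClass k i 0)) := by
  set q := φ X with hqdef
  have hnil : ∀ a, 0 < a → IsNilpotent (q ^ a) := fun a ha =>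
    ⟨N, by rw [← pow_mul]; exact pow_eq_zero_of_le (Nat.le_mul_of_pos_left N ha) hφ⟩
  have hadd : ∀ j, IsUnit (1 + q ^ (j + 1)) := fun j =>
    (hnil _ (Nat.succ_pos j)).isUnit_one_add
  have hsub : ∀ j, IsUnit (1 - q ^ (j + 1)) := fun j =>
    (hnil _ (Nat.succ_pos j)).isUnit_one_sub
  choose v hv using fun j => (hadd j).exists_right_inv
  have hpoch : ∀ n, IsUnit (pochhammerSelf (q ^ (2 * k)) n) := fun n =>
    IsUnit.prod_iff.mpr fun b _ => by
      rw [← pow_mul]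
      exact (hnil _ (Nat.mul_pos (by omega) (Nat.succ_pos b))).isUnit_one_sub
  choose y hy using fun n => (hpoch n).exists_right_inv
  -- A multiple of `2k`, so that products over residue classes factor without remainder, and at
  -- least `N`, so that classes of parts above `L` contribute `1`.
  set L := 2 * k * N with hL
  have hNL : N ≤ L := Nat.le_mul_of_pos_left N (by omega)
  have hone : ∀ {S : Set (Multiset (ℕ × Bool))}, S ⊆ partsAbove L → 0 ∈ S → φ (genFun S) = 1 := by
    intro S hS h0
    obtain ⟨c, hc⟩ := X_pow_dvd_genFun_sub_one hS h0
    have h := congrArg φ hc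
    rw [map_mul, map_pow, ← hqdef, pow_eq_zero_of_le (by omega) hφ, zero_mul, map_sub, map_one,
      sub_eq_zero] at h
    exact h
  have hD := mul_eq_sum_andrewsTerm hv hφ hNL hN (k := k)
    (fun i m => φ (genFun (differenceClass k i m)))
    (fun m => by simp only [differenceClass_zero, genFun_empty, map_zero])
    (fun i hi => hone (differenceClass_subset _ _ _)
      (zero_mem_differenceClass (by omega) (by omega) _))
    (fun i l m hk => by
      subst hk
      simp only [genFun_differenceClass_succ i l m, map_add, map_mul, map_pow, ← hqdef]) hik
  have hT := triple_product_eq_sum (by omega) (show k - i ≤ k by omega) hy hφ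
  have hsum : ∑ n ∈ range N, (-1) ^ n * q ^ (k * n ^ 2 + (k - i) * n) *
      (1 - q ^ ((2 * n + 1) * (k - (k - i)))) = ∑ n ∈ range N, andrewsTerm q v k i 0 n := by
    refine sum_congr rfl fun n _ => ?_
    simp [andrewsTerm, pochhammerRatio, Nat.sub_sub_self hik]
  rw [hsum, ← hD, Nat.sub_sub_self hik, show k + (k - i) = 2 * k - i by omega] at hT
  have hK := pochhammerRatio_zero_mul hv L
  set K := pochhammerRatio q v 0 L
  have hPunit : IsUnit (∏ j ∈ range L, (1 + q ^ (j + 1))) := IsUnit.prod_iff.mpr fun j _ => hadd j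
  have hKunit : IsUnit K := by
    have h : IsUnit (K * ∏ j ∈ range L, (1 + q ^ (j + 1))) := by
      rw [hK]
      exact IsUnit.prod_iff.mpr fun j _ => hsub j
    exact isUnit_of_mul_isUnit_left h
  refine hKunit.mul_left_cancel ?_
  rw [← hT]
  have hC : ∀ [DecidablePred A] [DecidablePred B], φ (genFun (restrictedClass A B 0)) *
      ∏ j ∈ range L, (if A (j + 1) then 1 - q ^ (j + 1) else 1) =
      ∏ j ∈ range L, (if B (j + 1) then 1 + q ^ (j + 1) else 1) := by
    intro _ _
    have h := congrArg φ (genFun_restrictedClass_mul_prod A B L)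
    rw [map_mul, map_mul, map_prod, map_prod,
      hone (restrictedClass_subset A B L) (zero_mem_restrictedClass A B L), mul_one] at h
    simpa only [apply_ite φ, map_sub, map_add, map_one, map_pow, ← hqdef] using h
  rcases hAB with ⟨rfl, rfl, rfl⟩ | ⟨hlt, rfl, rfl⟩
  · have h1 : (∏ j ∈ range L, (if ¬ i ∣ j + 1 then 1 - q ^ (j + 1) else 1)) *
        ∏ j ∈ range L, (if i ∣ j + 1 then 1 - q ^ (j + 1) else 1) =
        ∏ j ∈ range L, (1 - q ^ (j + 1)) := by
      rw [← prod_mul_distrib]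
      exact prod_congr rfl fun j _ => by split_ifs <;> simp_all
    have h2 : (∏ j ∈ range L, (if ¬ i ∣ j + 1 then 1 + q ^ (j + 1) else 1)) *
        ∏ j ∈ range L, (if i ∣ j + 1 then 1 + q ^ (j + 1) else 1) =
        ∏ j ∈ range L, (1 + q ^ (j + 1)) := by
      rw [← prod_mul_distrib]
      exact prod_congr rfl fun j _ => by split_ifs <;> simp_all
    have hL' : L = i * (2 * N) := by rw [hL]; ring
    have h3 : ∏ j ∈ range L, (if i ∣ j + 1 then 1 - q ^ (j + 1) else 1) =
        (∏ b ∈ range N, (1 - (q ^ i) ^ (2 * b + 1))) *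
          pochhammerSelf (q ^ (2 * i)) N := by
      rw [hL', prod_range_ite_dvd (fun a => 1 - q ^ a) (by omega), prod_range_mul_eq,
        pochhammerSelf, ← prod_mul_distrib]
      refine prod_congr rfl fun b _ => ?_
      rw [prod_range_succ, prod_range_one]
      ring
    have h4 : ∏ j ∈ range L, (if i ∣ j + 1 then 1 + q ^ (j + 1) else 1) =
        ∏ b ∈ range (2 * N), (1 + (q ^ i) ^ (b + 1)) := by
      rw [hL', prod_range_ite_dvd (fun a => 1 + q ^ a) (by omega)]
      exact prod_congr rfl fun b _ => by rw [pow_mul]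
    have h5 := prod_range_one_add_mul_odd (Q := q ^ i) (N := N) (by
      rw [← pow_mul]
      exact pow_eq_zero_of_le (Nat.le_mul_of_pos_left N (by omega)) hφ)
    have h6 : ∏ b ∈ range N, (1 - q ^ i * (q ^ (2 * i)) ^ b) =
        ∏ b ∈ range N, (1 - (q ^ i) ^ (2 * b + 1)) :=
      prod_congr rfl fun b _ => by ring
    rw [show 2 * i - i = i by omega, h6]
    rw [← h4] at h5
    rw [h3] at h1
    generalize (∏ b ∈ range N, (1 - (q ^ i) ^ (2 * b + 1))) = O at *
    generalize pochhammerSelf (q ^ (2 * i)) N = E at *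
    generalize (∏ j ∈ range L, (if i ∣ j + 1 then 1 + q ^ (j + 1) else 1)) = F at *
    refine hPunit.mul_right_cancel ?_
    specialize @hC _ _
    generalize φ (genFun (restrictedClass (fun a => ¬ i ∣ a) (fun a => ¬ i ∣ a) 0)) = γ at *
    generalize (∏ j ∈ range L, (if ¬ i ∣ j + 1 then 1 + q ^ (j + 1) else 1)) = b at *
    -- The triple product contains `O² E`, as `i = 2k - i` modulo `2k`. One factor `O E` accounts
    -- for the multiples of `i` missing on the non-overlined side; the other `O` is the inverse of
    -- `F` and accounts for the overlined side.
    linear_combination γ * hK - γ * h1 + O * E * hC + O ^ 2 * E * h2 - O * E * b * h5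
  · have h1 : (∏ j ∈ range L, (if ¬ ((j + 1) % (2 * k) = 0 ∨ (j + 1) % (2 * k) = i ∨
          (j + 1) % (2 * k) = 2 * k - i) then 1 - q ^ (j + 1) else 1)) *
        ∏ j ∈ range L, (if (j + 1) % (2 * k) = 0 ∨ (j + 1) % (2 * k) = i ∨
          (j + 1) % (2 * k) = 2 * k - i then 1 - q ^ (j + 1) else 1) =
        ∏ j ∈ range L, (1 - q ^ (j + 1)) := by
      rw [← prod_mul_distrib]
      exact prod_congr rfl fun j _ => by split_ifs <;> simp_all
    rw [prod_range_ite_mod q hi hlt N] at h1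
    specialize @hC _ _
    simp only [if_true] at hC
    refine hPunit.mul_right_cancel ?_
    rw [pochhammerSelf]
    linear_combination (φ (genFun (restrictedClass _ _ 0))) * hK -
      (φ (genFun (restrictedClass _ _ 0))) * h1 +
      (∏ b ∈ range N, (1 - q ^ i * (q ^ (2 * k)) ^ b)) * (∏ b ∈ range N,
        (1 - q ^ (2 * k - i) * (q ^ (2 * k)) ^ b)) *
        (∏ b ∈ range N, (1 - (q ^ (2 * k)) ^ (b + 1))) * hC

theorem ncard_eq_of_map_genFun_eq {S T : Set (Multiset (ℕ × Bool))} (n : ℕ)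
    (h : Ideal.Quotient.mk (Ideal.span {(X : ℤ⟦X⟧) ^ (n + 1)}) (genFun S) =
      Ideal.Quotient.mk (Ideal.span {(X : ℤ⟦X⟧) ^ (n + 1)}) (genFun T)) :
    (S ∩ {s | weight s = n}).ncard = (T ∩ {s | weight s = n}).ncard := by
  rw [Ideal.Quotient.eq, Ideal.mem_span_singleton, X_pow_dvd_iff] at h
  have h := h n (Nat.lt_succ_self n)
  rw [map_sub, genFun, genFun, coeff_mk, coeff_mk, sub_eq_zero] at h
  exact_mod_cast h

end Overpartition

theorem theorem1p4 (k i : ℕ) (hi : 1 ≤ i) (hik : i ≤ k) (n : ℕ) :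
    Overpartition.countC k i n = Overpartition.countD k i n := by
  have hX : Ideal.Quotient.mk (Ideal.span {(PowerSeries.X : PowerSeries ℤ) ^ (n + 1)})
      PowerSeries.X ^ (n + 1) = 0 := by
    rw [← map_pow, Ideal.Quotient.eq_zero_iff_mem]
    exact Ideal.mem_span_singleton_self _
  rw [Overpartition.countD_eq_ncard hi hik]
  rcases hik.eq_or_lt with rfl | hlt
  · rw [Overpartition.countC_self_eq_ncard]
    exact Overpartition.ncard_eq_of_map_genFun_eq n
      (Overpartition.map_genFun_eq _ (Nat.succ_pos n) hX hi hik (Or.inl ⟨rfl, rfl, rfl⟩))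
  · rw [Overpartition.countC_eq_ncard hi hlt]
    exact Overpartition.ncard_eq_of_map_genFun_eq n
      (Overpartition.map_genFun_eq _ (Nat.succ_pos n) hX hi hik (Or.inr ⟨hlt, rfl, rfl⟩))
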